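/- **Theorem 3.4.** Let $R$ be a commutative Noetherian ring, and let $B$ and $C$ be semidualizing $R$-modules. Here a finitely generated $R$-module $C$ is called semidualizing if the homothety map $R\to \mathrm{Hom}_R(C,C)$ is an isomorphism and $\mathrm{Ext}^i_R(C,C)=0$ for all $i>0$. Write $[X]\approx[Y]$ if $Y\cong X\otimes_R P$ for some finitely generated projective $R$-module $P$ of rank $1$. For $R$-modules $M,N$, let $L=(\cdots\to C\otimes_R P_1\to C\otimes_R P_0\to 0)$ be a proper $\mathscr P_C$-projective resolution of $M$, i.e. all $P_n$ are projective and $L$ is equipped with an augmentation $C\otimes_R P_0\to M$ such that the augmented sequence $L^+$ is a complex and $\mathrm{Hom}_R(C,L^+)$ is exact; put $\mathrm{Ext}^i_{\mathscr P_C}(M,N):=\mathrm H^i(\mathrm{Hom}_R(L,N))$. Let $J=(0\to\mathrm{Hom}_R(B,I^0)\to \mathrm{Hom}_R(B,I^1)\to\cdots)$ be a proper $\mathscr I_B$-injective resolution of $N$, i.e. all $I^n$ are injective and $J$ is equipped with an augmentation $N\to \mathrm{Hom}_R(B,I^0)$ such that the augmented sequence $J^+$ is a complex and $B\otimes_R J^+$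 is exact; put $\mathrm{Ext}^i_{\mathscr I_B}(M,N):=\mathrm H^i(\mathrm{Hom}_R(M,J))$. (Such resolutions always exist, and these modules do not depend on their choice up to isomorphism.) The following conditions are equivalent, where $\cong$ means that the two $R$-modules are isomorphic: 1. $[B]\approx[R]\approx[C]$; 2. $B$ and $C$ are projective $R$-modules; 3. $\mathrm{Ext}^i_{\mathscr P_C}(M,N)\cong\mathrm{Ext}^i_{\mathscr I_B}(M,N)$ for all $R$-modules $M$ and $N$ and all $i\ge 0$; 4. $\mathrm{Ext}^i_{\mathscr P_C}(C,R/\mathfrak m)\cong\mathrm{Ext}^i_{\mathscr I_B}(C,R/\mathfrak m)$ for all maximal ideals $\mathfrak m$ of $R$ and all $i\ge 0$; 5. $\mathrm{Ext}^0_{\mathscr P_C}(C,R/\mathfrak m)\cong\mathrm{Ext}^0_{\mathscr I_B}(C,R/\mathfrak m)$ and $\mathrm{Ext}^0_{\mathscr P_C}(B,R/\mathfrak m)\cong\mathrm{Ext}^0_{\mathscr I_B}(B,R/\mathfrak m)$ for all maximal ideals $\mathfrak m$ of $R$. -/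

import Mathlib

open CategoryTheory MonoidalCategory TensorProduct

universe u

namespace SemidualizingBalance

variable {R : Type u} [CommRing R]

/-- A finitely generated module `C` is semidualizing if the homothety map
`R → Hom_R(C, C)`, `r ↦ (c ↦ r • c)`, is bijective and `Ext^i_R(C, C) = 0` for all `i > 0`. -/
structure IsSemidualizing (C : ModuleCat.{u} R) : Prop where
  finite : Module.Finite R C
  homothety : Function.Bijective (LinearMap.lsmul R C)
  ext_eq_zero : ∀ i : ℕ, 0 < i → Subsingleton (Abelian.Ext C C i)

/-- `P` is a finitely generated projective module of rank one, i.e. its isomorphism class is an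
element of the Picard group. -/
structure IsPicard (P : ModuleCat.{u} R) : Prop where
  finite : Module.Finite R P
  projective : Module.Projective R P
  rank_one : ∀ p : PrimeSpectrum R, Module.rankAtStalk P p = 1

/-- The relation `[B] ≈ [C]`: `C ≅ B ⊗ P` for a finitely generated projective `P` of rank one. -/
def PicRel (B C : ModuleCat.{u} R) : Prop :=
  ∃ P : ModuleCat.{u} R, IsPicard P ∧ Nonempty (C ≃ₗ[R] B ⊗[R] P)

/-- `X` is `C`-projective: `X ≅ C ⊗ P` with `P` projective. -/
def IsCProjective (C X : ModuleCat.{u} R) : Prop :=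
  ∃ P : ModuleCat.{u} R, Module.Projective R P ∧ Nonempty (X ≃ₗ[R] C ⊗[R] P)

/-- `X` is `C`-injective: `X ≅ Hom(C, I)` with `I` injective. -/
def IsCInjective (C X : ModuleCat.{u} R) : Prop :=
  ∃ I : ModuleCat.{u} R, Module.Injective R I ∧ Nonempty (X ≃ₗ[R] (C →ₗ[R] I))

/-- The functor `Hom_R(M, -)`. -/
noncomputable abbrev homFunctor (M : ModuleCat.{u} R) : ModuleCat.{u} R ⥤ ModuleCat.{u} R :=
  (linearCoyoneda R (ModuleCat.{u} R)).obj (Opposite.op M)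

/-- A proper `𝒫_C`-projective resolution of `M`: a complex `⋯ → X₁ → X₀` of `C`-projective modules
with an augmentation `ε : X₀ → M` such that `Hom_R(C, X⁺)` is exact, where
`X⁺ = (⋯ → X₁ → X₀ → M → 0)` is the augmented complex (which itself need not be exact). -/
structure ProperProjRes (C M : ModuleCat.{u} R) where
  complex : ChainComplex (ModuleCat.{u} R) ℕ
  isCProjective : ∀ n, IsCProjective C (complex.X n)
  ε : complex.X 0 ⟶ M
  d_comp_ε : complex.d 1 0 ≫ ε = 0
  acyclic : (((homFunctor C).mapHomologicalComplex (ComplexShape.down ℕ)).obj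
    (complex.augment ε d_comp_ε)).Acyclic

/-- A proper `ℐ_C`-injective resolution of `M`: a complex `Y⁰ → Y¹ → ⋯` of `C`-injective modules
with an augmentation `η : M → Y⁰` such that `C ⊗_R Y⁺` is exact, where
`Y⁺ = (0 → M → Y⁰ → Y¹ → ⋯)` is the augmented complex (which itself need not be exact). -/
structure ProperInjRes (C M : ModuleCat.{u} R) where
  complex : CochainComplex (ModuleCat.{u} R) ℕ
  isCInjective : ∀ n, IsCInjective C (complex.X n)
  η : M ⟶ complex.X 0
  η_comp_d : η ≫ complex.d 0 1 = 0
  acyclic : (((tensorLeft C).mapHomologicalComplex (ComplexShape.up ℕ)).obj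
    (complex.augment η η_comp_d)).Acyclic

/-! ### Every module has proper resolutions -/

section Existence

open Limits

lemma exact_epi_comp_mono {A K X Y Z : ModuleCat.{u} R} (p : A ⟶ K) (k : K ⟶ X) (q : X ⟶ Y)
    (j : Y ⟶ Z) [Epi p] [Mono j] (w₀ : k ≫ q = 0) (h : (ShortComplex.mk k q w₀).Exact)
    (f : A ⟶ X) (g : X ⟶ Z) (hf : f = p ≫ k) (hg : g = q ≫ j) (w : f ≫ g = 0) :
    (ShortComplex.mk f g w).Exact := by
  subst hf hg
  rw [ShortComplex.moduleCat_exact_iff] at h ⊢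
  intro x hx
  have hj : Function.Injective j := (ModuleCat.mono_iff_injective j).1 inferInstance
  have hp : Function.Surjective p := (ModuleCat.epi_iff_surjective p).1 inferInstance
  obtain ⟨y, hy⟩ := h x (hj (by simpa using hx))
  obtain ⟨z, rfl⟩ := hp y
  exact ⟨z, by simpa using hy⟩

lemma exact_map_of_kernel (G : ModuleCat.{u} R ⥤ ModuleCat.{u} R) [G.Additive]
    [PreservesFiniteLimits G] {A X Y Z : ModuleCat.{u} R} (q : X ⟶ Y) (p : A ⟶ kernel q)
    (j : Y ⟶ Z) (hp : Epi (G.map p)) (hj : Mono (G.map j)) (f : A ⟶ X) (g : X ⟶ Z)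
    (hf : f = p ≫ kernel.ι q) (hg : g = q ≫ j) (w : G.map f ≫ G.map g = 0) :
    (ShortComplex.mk (G.map f) (G.map g) w).Exact := by
  have h0 := (ShortComplex.exact_kernel q).map_of_mono_of_preservesKernel G
    (by dsimp; infer_instance) inferInstance
  exact exact_epi_comp_mono (G.map p) (G.map (kernel.ι q)) (G.map q) (G.map j) _ h0 _ _
    (by rw [hf, G.map_comp]) (by rw [hg, G.map_comp]) w

lemma exact_map_of_cokernel (G : ModuleCat.{u} R ⥤ ModuleCat.{u} R) [G.Additive]
    [PreservesFiniteColimits G] {A X Y Z : ModuleCat.{u} R} (q : A ⟶ X) (p : cokernel q ⟶ Z)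
    (j : Y ⟶ A) (hp : Mono (G.map p)) (hj : Epi (G.map j)) (f : Y ⟶ X) (g : X ⟶ Z)
    (hf : f = j ≫ q) (hg : g = cokernel.π q ≫ p) (w : G.map f ≫ G.map g = 0) :
    (ShortComplex.mk (G.map f) (G.map g) w).Exact := by
  have h0 := (ShortComplex.exact_cokernel q).map_of_epi_of_preservesCokernel G
    (by dsimp; infer_instance) inferInstance
  exact exact_epi_comp_mono (G.map j) (G.map q) (G.map (cokernel.π q)) (G.map p) _ h0 _ _
    (by rw [hf, G.map_comp]) (by rw [hg, G.map_comp]) w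

instance (C : ModuleCat.{u} R) : PreservesFiniteLimits (homFunctor C) :=
  inferInstanceAs (PreservesFiniteLimits (ihom C))

/-- Every module receives a map from a `C`-projective module through which all maps from `C`
factor. -/
lemma exists_cover (C M : ModuleCat.{u} R) : ∃ (X : ModuleCat.{u} R) (p : X ⟶ M),
    IsCProjective C X ∧ Epi ((homFunctor C).map p) := by
  classical
  let P := (C →ₗ[R] M) →₀ R
  let t : C ⊗[R] P →ₗ[R] M := TensorProduct.lift
    (LinearMap.flip (Finsupp.lsum R (fun f : C →ₗ[R] M => LinearMap.toSpanSingleton R _ f)))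
  refine ⟨ModuleCat.of R (C ⊗[R] P), ModuleCat.ofHom t,
    ⟨ModuleCat.of R P, inferInstanceAs (Module.Projective R P), ⟨LinearEquiv.refl _ _⟩⟩, ?_⟩
  rw [ModuleCat.epi_iff_surjective]
  intro f
  refine ⟨ModuleCat.ofHom ((TensorProduct.mk R C P).flip (Finsupp.single f.hom 1)), ?_⟩
  change ModuleCat.ofHom _ ≫ ModuleCat.ofHom _ = f
  ext c
  change t (c ⊗ₜ[R] Finsupp.single f.hom (1 : R)) = f.hom c
  dsimp only [t]
  rw [TensorProduct.lift.tmul, LinearMap.flip_apply, Finsupp.lsum_single]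
  simp

/-- Every module maps to a `C`-injective module by a map that stays injective after applying
`C ⊗ -`. -/
lemma exists_envelope (C M : ModuleCat.{u} R) : ∃ (X : ModuleCat.{u} R) (p : M ⟶ X),
    IsCInjective C X ∧ Mono ((tensorLeft C).map p) := by
  let I := Injective.under (C ⊗ M)
  let i : C ⊗ M ⟶ I := Injective.ι (C ⊗ M)
  let t : M →ₗ[R] (C →ₗ[R] I) := (TensorProduct.mk R C M).flip.compr₂ i.hom
  refine ⟨ModuleCat.of R (C →ₗ[R] I), ModuleCat.ofHom t,
    ⟨I, (Module.injective_iff_injective_object R I).2 (inferInstanceAs (Injective I)),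
      ⟨LinearEquiv.refl _ _⟩⟩, ?_⟩
  let e : C ⊗ ModuleCat.of R (C →ₗ[R] I) ⟶ I :=
    ModuleCat.ofHom (TensorProduct.lift (LinearMap.id (R := R) (M := C →ₗ[R] I)).flip)
  have h : (tensorLeft C).map (ModuleCat.ofHom t) ≫ e = i := by
    apply ModuleCat.hom_ext
    apply TensorProduct.ext'
    intro c m
    rfl
  have : Mono ((tensorLeft C).map (ModuleCat.ofHom t) ≫ e) := by
    rw [h]
    exact Injective.ι_mono _
  exact mono_of_mono _ e

theorem nonempty_properProjRes (C M : ModuleCat.{u} R) : Nonempty (ProperProjRes C M) := by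
  choose F p hF hp using exists_cover C
  let K : ℕ → ModuleCat.{u} R := fun n =>
    Nat.rec (motive := fun _ => ModuleCat.{u} R) M (fun _ Z => kernel (p Z)) n
  let X : ℕ → ModuleCat.{u} R := fun n => F (K n)
  let k : ∀ n, K (n + 1) ⟶ F (K n) := fun n => (kernel.ι (p (K n)) :)
  have hk : ∀ n, k n ≫ p (K n) = 0 := fun n => kernel.condition (p (K n))
  let d : ∀ n, X (n + 1) ⟶ X n := fun n => p (K (n + 1)) ≫ k n
  have hd : ∀ n, d (n + 1) ≫ d n = 0 := fun n => by
    change (p _ ≫ k (n + 1)) ≫ p (K (n + 1)) ≫ k n = 0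
    rw [Category.assoc, reassoc_of% (hk (n + 1)), zero_comp, comp_zero]
  have hε : (ChainComplex.of X d hd).d 1 0 ≫ p M = 0 := by
    rw [show (ChainComplex.of X d hd).d 1 0 = d 0 from ChainComplex.of_d X d 0]
    change (p _ ≫ k 0) ≫ p (K 0) = 0
    rw [Category.assoc, hk, comp_zero]
  refine ⟨⟨ChainComplex.of X d hd, fun n => hF _, p M, hε, ?_⟩⟩
  intro n
  match n with
  | 0 =>
    rw [HomologicalComplex.exactAt_iff' _ 1 0 0 (by simp) (by simp)]
    refine (ShortComplex.exact_iff_epi _ ?_).2 (hp M)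
    exact HomologicalComplex.shape (((homFunctor C).mapHomologicalComplex (ComplexShape.down ℕ)).obj
      ((ChainComplex.of X d hd).augment (p M) hε)) 0 0 (by simp)
  | 1 =>
    rw [HomologicalComplex.exactAt_iff' _ 2 1 0 (by simp) (by simp)]
    refine exact_map_of_kernel (homFunctor C) (p M) (p (kernel (p M))) (𝟙 M) (hp _)
      (by rw [CategoryTheory.Functor.map_id]; infer_instance) _ _ ?_ ?_ _
    · exact ChainComplex.of_d X d 0
    · exact (Category.comp_id _).symm
  | n + 2 =>
    rw [HomologicalComplex.exactAt_iff' _ (n + 3) (n + 2) (n + 1) (by simp) (by simp)]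
    refine exact_map_of_kernel (homFunctor C) (p (K (n + 1))) (p (kernel (p (K (n + 1)))))
      (kernel.ι (p (K n))) (hp _) inferInstance _ _ ?_ ?_ _
    · exact ChainComplex.of_d X d (n + 1)
    · exact ChainComplex.of_d X d n

theorem nonempty_properInjRes (C M : ModuleCat.{u} R) : Nonempty (ProperInjRes C M) := by
  choose F p hF hp using exists_envelope C
  let K : ℕ → ModuleCat.{u} R := fun n =>
    Nat.rec (motive := fun _ => ModuleCat.{u} R) M (fun _ Z => cokernel (p Z)) n
  let X : ℕ → ModuleCat.{u} R := fun n => F (K n)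
  let k : ∀ n, F (K n) ⟶ K (n + 1) := fun n => (cokernel.π (p (K n)) :)
  have hk : ∀ n, p (K n) ≫ k n = 0 := fun n => cokernel.condition (p (K n))
  let d : ∀ n, X n ⟶ X (n + 1) := fun n => k n ≫ p (K (n + 1))
  have hd : ∀ n, d n ≫ d (n + 1) = 0 := fun n => by
    change (k n ≫ p (K (n + 1))) ≫ k (n + 1) ≫ p _ = 0
    rw [Category.assoc, reassoc_of% (hk (n + 1)), zero_comp, comp_zero]
  have hη : p M ≫ (CochainComplex.of X d hd).d 0 1 = 0 := by
    rw [show (CochainComplex.of X d hd).d 0 1 = d 0 from CochainComplex.of_d X d 0]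
    change p (K 0) ≫ k 0 ≫ p _ = 0
    rw [reassoc_of% (hk 0), zero_comp]
  refine ⟨⟨CochainComplex.of X d hd, fun n => hF _, p M, hη, ?_⟩⟩
  intro n
  match n with
  | 0 =>
    rw [HomologicalComplex.exactAt_iff' _ 0 0 1 (by simp) (by simp)]
    refine (ShortComplex.exact_iff_mono _ ?_).2 (hp M)
    exact HomologicalComplex.shape (((tensorLeft C).mapHomologicalComplex (ComplexShape.up ℕ)).obj
      ((CochainComplex.of X d hd).augment (p M) hη)) 0 0 (by simp)
  | 1 =>
    rw [HomologicalComplex.exactAt_iff' _ 0 1 2 (by simp) (by simp)]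
    refine exact_map_of_cokernel (tensorLeft C) (p M) (p (cokernel (p M))) (𝟙 M) (hp _)
      (by rw [CategoryTheory.Functor.map_id]; infer_instance) _ _ ?_ ?_ _
    · exact (Category.id_comp _).symm
    · exact CochainComplex.of_d X d 0
  | n + 2 =>
    rw [HomologicalComplex.exactAt_iff' _ (n + 1) (n + 2) (n + 3) (by simp) (by simp)]
    refine exact_map_of_cokernel (tensorLeft C) (p (K (n + 1))) (p (cokernel (p (K (n + 1)))))
      (cokernel.π (p (K n))) (hp _) inferInstance _ _ ?_ ?_ _
    · exact CochainComplex.of_d X d n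
    · exact CochainComplex.of_d X d (n + 1)

end Existence

/-- A chosen proper `𝒫_C`-projective resolution of `M`. -/
noncomputable def properProjRes (C M : ModuleCat.{u} R) : ProperProjRes C M :=
  (nonempty_properProjRes C M).some

/-- A chosen proper `ℐ_C`-injective resolution of `M`. -/
noncomputable def properInjRes (C M : ModuleCat.{u} R) : ProperInjRes C M :=
  (nonempty_properInjRes C M).some

/-- `Ext^n_{𝒫_C}(M, N)`: the `n`-th cohomology module of `Hom_R(L, N)`, with `L` a proper
`𝒫_C`-projective resolution of `M`. -/
noncomputable def ExtProj (C M N : ModuleCat.{u} R) (n : ℕ) : ModuleCat.{u} R :=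
  ((properProjRes C M).complex.linearYonedaObj R N).homology n

/-- `Ext^n_{ℐ_C}(M, N)`: the `n`-th cohomology module of `Hom_R(M, J)`, with `J` a proper
`ℐ_C`-injective resolution of `N`. -/
noncomputable def ExtInj (C M N : ModuleCat.{u} R) (n : ℕ) : ModuleCat.{u} R :=
  (((homFunctor M).mapHomologicalComplex (ComplexShape.up ℕ)).obj
    (properInjRes C N).complex).homology n

end SemidualizingBalance

open SemidualizingBalance

-- Because Hom(C, C ⊗ P) ≅ P for projective P, the functor Hom(C, -) turns a proper `𝒫_C`-resolution
-- of M into a projective resolution of Hom(C, M), and it is bijective on maps from C ⊗ P to N.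
-- Hence Ext_{𝒫_C}(M, N) ≅ Ext(Hom(C, M), Hom(C, N)) (`extProj_equiv_ext`). Dually, B ⊗ Hom(B, I) ≅
-- I for injective I gives Ext_{ℐ_B}(M, N) ≅ Ext(B ⊗ M, B ⊗ N) (`extInj_equiv_ext`).
--
-- If B and C are projective, they are invertible. Then Hom(C, -) and B ⊗ - reflect exactness,
-- proper resolutions are ordinary ones, and both sides are Ext(M, N).
--
-- Conversely, put k = R/m and let b, c be the fiber dimensions of B, C at m. Degree 0 with M = C
-- compares Hom(R, Hom(C, k)) with Hom(B ⊗ C, B ⊗ k), so c = b·c·b. Since c ≠ 0, b = 1, and a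
-- faithful finite module with all fibers one-dimensional is projective
-- (`Module.Projective.of_finrank_fiber_eq_one`). For C there are two routes. Degree 1 gives Ext¹(C,
-- k) ≅ Ext¹(R, Hom(C, k)) = 0. Alternatively, degree 0 with M = B gives dim(k ⊗ Hom(C, B))·c = b³ =
-- 1.

universe v w

namespace CategoryTheory

open Limits Abelian

/-! ### Ext classes represented by cocycles of a resolution. -/

section Resolutions

variable {𝒜 : Type u} [Category.{v} 𝒜] [Abelian 𝒜]

/-- An exact augmented chain complex of projectives is a projective resolution. -/
noncomputable def ProjectiveResolution.ofExact {Z : 𝒜} (K : ChainComplex 𝒜 ℕ) (ε : K.X 0 ⟶ Z)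
    (w : K.d 1 0 ≫ ε = 0) (hK : ∀ n, Projective (K.X n)) (hε : Epi ε)
    (h₀ : (ShortComplex.mk _ _ w).Exact) (h : ∀ n, K.ExactAt (n + 1)) :
    ProjectiveResolution Z where
  complex := K
  projective := hK
  π := (ChainComplex.toSingle₀Equiv _ _).symm ⟨ε, w⟩
  quasiIso := ⟨fun n => by
    cases n
    · rw [ChainComplex.quasiIsoAt₀_iff, ShortComplex.quasiIso_iff_of_zeros']
      · refine (ShortComplex.exact_and_epi_g_iff_of_iso ?_).2 ⟨h₀, hε⟩
        exact ShortComplex.isoMk (Iso.refl _) (Iso.refl _) (Iso.refl _)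
          ((Category.id_comp _).trans (Category.comp_id _).symm)
          ((Category.id_comp _).trans (((Category.comp_id _).trans
            (ChainComplex.toSingle₀Equiv_symm_apply_f_zero ε w)).symm))
      · exact K.shape 0 0 (by simp)
      all_goals rfl
    · rw [quasiIsoAt_iff_exactAt']
      · apply h
      · apply ChainComplex.exactAt_succ_single_obj⟩

/-- An exact augmented cochain complex of injectives is an injective resolution. -/
noncomputable def InjectiveResolution.ofExact {Z : 𝒜} (K : CochainComplex 𝒜 ℕ) (η : Z ⟶ K.X 0)
    (w : η ≫ K.d 0 1 = 0) (hK : ∀ n, Injective (K.X n)) (hη : Mono η)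
    (h₀ : (ShortComplex.mk _ _ w).Exact) (h : ∀ n, K.ExactAt (n + 1)) :
    InjectiveResolution Z where
  cocomplex := K
  injective := hK
  ι := (CochainComplex.fromSingle₀Equiv _ _).symm ⟨η, w⟩
  quasiIso := ⟨fun n => by
    cases n
    · rw [CochainComplex.quasiIsoAt₀_iff, ShortComplex.quasiIso_iff_of_zeros]
      · refine (ShortComplex.exact_and_mono_f_iff_of_iso ?_).2 ⟨h₀, hη⟩
        exact ShortComplex.isoMk (Iso.refl _) (Iso.refl _) (Iso.refl _)
          ((Category.id_comp _).trans (((Category.comp_id _).trans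
            (CochainComplex.fromSingle₀Equiv_symm_apply_f_zero η w)).symm))
          ((Category.id_comp _).trans (Category.comp_id _).symm)
      · rfl
      · rfl
      · exact K.shape 0 0 (by simp)
    · rw [quasiIsoAt_iff_exactAt]
      · apply h
      · apply CochainComplex.exactAt_succ_single_obj⟩

variable [HasExt.{w} 𝒜] {X Y : 𝒜}

open CochainComplex.HomComplex

/-- The resolution vanishes in cohomological degree 1, so degree zero has no nonzero coboundaries.
-/
lemma ProjectiveResolution.extMk_zero_eq_zero_iff (P : ProjectiveResolution X)
    (f : P.complex.X 0 ⟶ Y) (hf : P.complex.d 1 0 ≫ f = 0) :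
    P.extMk f 1 rfl hf = 0 ↔ f = 0 := by
  refine ⟨fun h => ?_, fun h => by subst h; simp⟩
  simp only [← P.extEquivCohomologyClass.apply_eq_iff_eq,
    extEquivCohomologyClass_extMk, extEquivCohomologyClass_zero,
    CohomologyClass.mk_eq_zero_iff] at h
  rw [Cocycle.toSingleMk_mem_coboundaries_iff _ _ _ _ _ 1 (by lia)] at h
  obtain ⟨g, hg⟩ := h
  have hz : IsZero (P.cochainComplex.X 1) := P.cochainComplex.isZero_of_isStrictlyLE 0 1
  rw [hz.eq_of_src g 0, comp_zero] at hg
  rw [← cancel_epi (P.cochainComplexXIso (-(0 : ℕ)) 0 rfl).hom, comp_zero]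
  exact hg.symm

lemma InjectiveResolution.extMk_zero_eq_zero_iff (I : InjectiveResolution Y)
    (f : X ⟶ I.cocomplex.X 0) (hf : f ≫ I.cocomplex.d 0 1 = 0) :
    I.extMk f 1 rfl hf = 0 ↔ f = 0 := by
  refine ⟨fun h => ?_, fun h => by subst h; simp⟩
  simp only [← I.extEquivCohomologyClass.apply_eq_iff_eq,
    extEquivCohomologyClass_extMk, extEquivCohomologyClass_zero,
    CohomologyClass.mk_eq_zero_iff] at h
  rw [Cocycle.fromSingleMk_mem_coboundaries_iff _ _ _ _ _ (-1) (by lia)] at h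
  obtain ⟨g, hg⟩ := h
  have hz : IsZero (I.cochainComplex.X (-1)) := I.cochainComplex.isZero_of_isStrictlyGE 0 (-1)
  rw [hz.eq_of_tgt g 0, zero_comp] at hg
  rw [← cancel_mono (I.cochainComplexXIso (0 : ℕ) 0 rfl).inv, zero_comp]
  exact hg.symm

variable {R : Type*} [CommRing R] [Linear R 𝒜]

lemma ProjectiveResolution.smul_extMk (P : ProjectiveResolution X) {n : ℕ} (r : R)
    (f : P.complex.X n ⟶ Y) (m : ℕ) (hm : n + 1 = m) (hf : P.complex.d m n ≫ f = 0) :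
    r • P.extMk f m hm hf = P.extMk (r • f) m hm (by simp [hf]) := by
  rw [Ext.smul_eq_comp_mk₀, extMk_comp_mk₀]
  congr 1
  simp

/-- A cocycle into an injective resolution of `Y` is natural in `X`, so the scalar is moved to
precomposition with `r • 𝟙 X`. -/
lemma InjectiveResolution.smul_extMk (I : InjectiveResolution Y) {n : ℕ} (r : R)
    (f : X ⟶ I.cocomplex.X n) (m : ℕ) (hm : n + 1 = m) (hf : f ≫ I.cocomplex.d n m = 0) :
    r • I.extMk f m hm hf = I.extMk (r • f) m hm (by simp [hf]) := by
  have h : r • I.extMk f m hm hf =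
      (Ext.mk₀ (r • 𝟙 X)).comp (I.extMk f m hm hf) (zero_add _) := by
    rw [Ext.mk₀_smul, Ext.smul_comp, Ext.mk₀_id_comp]
  rw [h, mk₀_comp_extMk]
  congr 1
  simp

end Resolutions

section Homology

variable {R : Type u} [CommRing R]

/-- First isomorphism theorem: `Φ` is onto and its kernel is the coboundaries. Using `prev` also
covers `i = 0`, where `prev 0 = 0` and the incoming differential is zero. -/
lemma homologyEquiv_of_cocycles {E : Type*} [AddCommGroup E] [Module R E]
    (K : CochainComplex (ModuleCat.{v} R) ℕ) (i : ℕ)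
    (Φ : LinearMap.ker (K.d i (i + 1)).hom →ₗ[R] E) (hΦ : Function.Surjective Φ)
    (hker : ∀ x, Φ x = 0 ↔
      ∃ y, (K.d ((ComplexShape.up ℕ).prev i) i).hom y = (x : K.X i)) :
    Nonempty (K.homology i ≃ₗ[R] E) := by
  let S := K.sc' ((ComplexShape.up ℕ).prev i) i (i + 1)
  let e : K.homology i ≅ S.homology :=
    ShortComplex.homologyMapIso (K.isoSc' _ i (i + 1) rfl (by simp))
  let Ψ : LinearMap.ker S.g.hom →ₗ[R] E := Φ
  have hS : LinearMap.range S.moduleCatToCycles = LinearMap.ker Ψ := by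
    ext x
    rw [LinearMap.mem_ker, LinearMap.mem_range]
    exact (exists_congr fun y => Subtype.ext_iff).trans (hker x).symm
  exact ⟨(e ≪≫ S.moduleCatHomologyIso).toLinearEquiv ≪≫ₗ Submodule.quotEquivOfEq _ _ hS ≪≫ₗ
    Ψ.quotKerEquivOfSurjective hΦ⟩

end Homology

/-! ### Cohomology of Hom complexes as Ext, through a comparison functor. -/

section Comparison

variable {R : Type u} [CommRing R] {𝒜 ℬ : Type*} [Category* 𝒜] [Category* ℬ]
  [Abelian 𝒜] [Abelian ℬ] [HasExt.{w} ℬ] [Linear R 𝒜] [Linear R ℬ]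
  (G : 𝒜 ⥤ ℬ) [G.Additive] [G.Linear R]

/-- If `G` turns an augmented complex `X → M` into a projective resolution of `G M` and induces
bijections `Hom(Xₙ, N) → Hom(G Xₙ, G N)`, then the cohomology of `Hom(X, N)` is
`Ext(G M, G N)`. -/
lemma linearYonedaObj_homology_equiv_ext (X : ChainComplex 𝒜 ℕ) (M N : 𝒜) (ε : X.X 0 ⟶ M)
    (w : X.d 1 0 ≫ ε = 0)
    (hX : ((G.mapHomologicalComplex (ComplexShape.down ℕ)).obj (X.augment ε w)).Acyclic)
    (hproj : ∀ n, Projective (G.obj (X.X n)))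
    (hbij : ∀ n, Function.Bijective (G.map : (X.X n ⟶ N) → (G.obj (X.X n) ⟶ G.obj N))) (i : ℕ) :
    Nonempty ((X.linearYonedaObj R N).homology i ≃ₗ[R] Ext (G.obj M) (G.obj N) i) := by
  let K := (G.mapHomologicalComplex (ComplexShape.down ℕ)).obj X
  have wK : K.d 1 0 ≫ G.map ε = 0 := by
    change G.map _ ≫ G.map _ = 0
    rw [← G.map_comp, w, G.map_zero]
  -- Augmenting shifts degrees by one: acyclicity in degree 0 says that `G.map ε` is epi, in degree
  -- 1 exactness at `K.X 0`, in degree `n + 2` exactness at `K.X (n + 1)`.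
  let P : ProjectiveResolution (G.obj M) := ProjectiveResolution.ofExact K (G.map ε) wK hproj
    (by
      have h := hX 0
      rw [HomologicalComplex.exactAt_iff' _ 1 0 0 (by simp) (by simp)] at h
      refine (ShortComplex.exact_iff_epi _ ?_).1 h
      exact ((G.mapHomologicalComplex _).obj (X.augment ε w)).shape 0 0 (by simp))
    (by
      have h := hX 1
      rwa [HomologicalComplex.exactAt_iff' _ 2 1 0 (by simp) (by simp)] at h)
    (fun n => by
      have h := hX (n + 2)
      rw [HomologicalComplex.exactAt_iff' _ (n + 3) (n + 2) (n + 1) (by simp) (by simp)] at h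
      rw [HomologicalComplex.exactAt_iff' _ (n + 2) (n + 1) n (by simp) (by simp)]
      exact h)
  let φ : LinearMap.ker ((X.linearYonedaObj R N).d i (i + 1)).hom → (X.X i ⟶ N) := fun f => f.1
  let ψ : LinearMap.ker ((X.linearYonedaObj R N).d i (i + 1)).hom →
      (P.complex.X i ⟶ G.obj N) := fun f => G.map (φ f)
  have hf : ∀ f : LinearMap.ker ((X.linearYonedaObj R N).d i (i + 1)).hom,
      P.complex.d (i + 1) i ≫ ψ f = 0 := fun f => by
    have h : X.d (i + 1) i ≫ (φ f) = 0 := f.2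
    change G.map _ ≫ G.map _ = 0
    rw [← G.map_comp, h, G.map_zero]
  let Φ : LinearMap.ker ((X.linearYonedaObj R N).d i (i + 1)).hom →ₗ[R]
      Ext (G.obj M) (G.obj N) i :=
    { toFun := fun f => P.extMk (ψ f) (i + 1) rfl (hf f)
      map_add' := fun f g => by
        rw [P.add_extMk]
        congr 1
        exact G.map_add
      map_smul' := fun r f => by
        rw [RingHom.id_apply, P.smul_extMk]
        congr 1
        exact Functor.Linear.map_smul (F := G) (φ f) r }
  refine homologyEquiv_of_cocycles _ i Φ (fun α => ?_) (fun f => ?_)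
  · obtain ⟨g, hg, rfl⟩ := P.extMk_surjective α (i + 1) rfl
    obtain ⟨f, rfl⟩ := (hbij i).2 g
    refine ⟨⟨f, ?_⟩, rfl⟩
    change X.d (i + 1) i ≫ f = 0
    -- Surjectivity in degree `i` lifts the cocycle; injectivity in degree `i + 1` shows that the
    -- lift is still a cocycle.
    apply (hbij (i + 1)).1
    rw [G.map_comp, G.map_zero]
    exact hg
  · cases i with
    | zero =>
      refine (P.extMk_zero_eq_zero_iff _ (hf f)).trans ?_
      have h0 : ∀ y, ((X.linearYonedaObj R N).d ((ComplexShape.up ℕ).prev 0) 0).hom y = 0 := by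
        intro y
        rw [HomologicalComplex.shape _ _ _ (by simp)]
        rfl
      refine Iff.trans (b := φ f = 0) ⟨fun h => (hbij 0).1 (h.trans (G.map_zero _ _).symm),
        fun h => (congrArg G.map h).trans (G.map_zero _ _)⟩ ?_
      exact ⟨fun h => ⟨0, (h0 0).trans h.symm⟩, fun ⟨y, hy⟩ => hy.symm.trans (h0 y)⟩
    | succ n =>
      rw [CochainComplex.prev_nat_succ]
      refine (P.extMk_eq_zero_iff _ _ rfl (hf f) n rfl).trans ⟨?_, ?_⟩
      · rintro ⟨g, hg⟩
        obtain ⟨g, rfl⟩ := (hbij n).2 g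
        refine ⟨g, ?_⟩
        apply (hbij (n + 1)).1
        exact (G.map_comp _ _).trans hg
      · rintro ⟨g, hg⟩
        exact ⟨G.map (Y := N) g, (G.map_comp _ _).symm.trans
          (congrArg (fun t : X.X (n + 1) ⟶ N => G.map t) hg)⟩

/-- If `G` turns a coaugmented complex `N → Y` into an injective resolution of `G N` and induces
bijections `Hom(M, Yⁿ) → Hom(G M, G Yⁿ)`, then the cohomology of `Hom(M, Y)` is
`Ext(G M, G N)`. -/
lemma linearCoyoneda_homology_equiv_ext (Y : CochainComplex 𝒜 ℕ) (M N : 𝒜) (η : N ⟶ Y.X 0)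
    (w : η ≫ Y.d 0 1 = 0)
    (hY : ((G.mapHomologicalComplex (ComplexShape.up ℕ)).obj (Y.augment η w)).Acyclic)
    (hinj : ∀ n, Injective (G.obj (Y.X n)))
    (hbij : ∀ n, Function.Bijective (G.map : (M ⟶ Y.X n) → (G.obj M ⟶ G.obj (Y.X n)))) (i : ℕ) :
    Nonempty (((((linearCoyoneda R 𝒜).obj (Opposite.op M)).mapHomologicalComplex
      (ComplexShape.up ℕ)).obj Y).homology i ≃ₗ[R] Ext (G.obj M) (G.obj N) i) := by
  let K := (G.mapHomologicalComplex (ComplexShape.up ℕ)).obj Y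
  let H := (((linearCoyoneda R 𝒜).obj (Opposite.op M)).mapHomologicalComplex
      (ComplexShape.up ℕ)).obj Y
  have wK : G.map η ≫ K.d 0 1 = 0 := by
    change G.map _ ≫ G.map _ = 0
    rw [← G.map_comp, w, G.map_zero]
  let I : InjectiveResolution (G.obj N) := InjectiveResolution.ofExact K (G.map η) wK hinj
    (by
      have h := hY 0
      rw [HomologicalComplex.exactAt_iff' _ 0 0 1 (by simp) (by simp)] at h
      refine (ShortComplex.exact_iff_mono _ ?_).1 h
      exact ((G.mapHomologicalComplex _).obj (Y.augment η w)).shape 0 0 (by simp))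
    (by
      have h := hY 1
      rwa [HomologicalComplex.exactAt_iff' _ 0 1 2 (by simp) (by simp)] at h)
    (fun n => by
      have h := hY (n + 2)
      rw [HomologicalComplex.exactAt_iff' _ (n + 1) (n + 2) (n + 3) (by simp) (by simp)] at h
      rw [HomologicalComplex.exactAt_iff' _ n (n + 1) (n + 2) (by simp) (by simp)]
      exact h)
  let φ : LinearMap.ker (H.d i (i + 1)).hom → (M ⟶ Y.X i) := fun f => f.1
  let ψ : LinearMap.ker (H.d i (i + 1)).hom → (G.obj M ⟶ I.cocomplex.X i) :=
    fun f => G.map (φ f)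
  have hf : ∀ f : LinearMap.ker (H.d i (i + 1)).hom,
      ψ f ≫ I.cocomplex.d i (i + 1) = 0 := fun f => by
    have h : (φ f) ≫ Y.d i (i + 1) = 0 := f.2
    change G.map _ ≫ G.map _ = 0
    rw [← G.map_comp, h, G.map_zero]
  let Φ : LinearMap.ker (H.d i (i + 1)).hom →ₗ[R] Ext (G.obj M) (G.obj N) i :=
    { toFun := fun f => I.extMk (ψ f) (i + 1) rfl (hf f)
      map_add' := fun f g => by
        rw [I.add_extMk]
        congr 1
        exact G.map_add
      map_smul' := fun r f => by
        rw [RingHom.id_apply, I.smul_extMk]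
        congr 1
        exact Functor.Linear.map_smul (F := G) (φ f) r }
  refine homologyEquiv_of_cocycles H i Φ (fun α => ?_) (fun f => ?_)
  · obtain ⟨g, hg, rfl⟩ := I.extMk_surjective α (i + 1) rfl
    obtain ⟨f, rfl⟩ := (hbij i).2 g
    refine ⟨⟨f, ?_⟩, rfl⟩
    change f ≫ Y.d i (i + 1) = 0
    apply (hbij (i + 1)).1
    rw [G.map_comp, G.map_zero]
    exact hg
  · cases i with
    | zero =>
      refine (I.extMk_zero_eq_zero_iff _ (hf f)).trans ?_
      have h0 : ∀ y, (H.d ((ComplexShape.up ℕ).prev 0) 0).hom y = 0 := by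
        intro y
        rw [HomologicalComplex.shape _ _ _ (by simp)]
        rfl
      refine Iff.trans (b := φ f = 0) ⟨fun h => (hbij 0).1 (h.trans (G.map_zero _ _).symm),
        fun h => (congrArg G.map h).trans (G.map_zero _ _)⟩ ?_
      exact ⟨fun h => ⟨0, (h0 0).trans h.symm⟩, fun ⟨y, hy⟩ => hy.symm.trans (h0 y)⟩
    | succ n =>
      rw [CochainComplex.prev_nat_succ]
      refine (I.extMk_eq_zero_iff _ _ rfl (hf f) n rfl).trans ⟨?_, ?_⟩
      · rintro ⟨g, hg⟩
        obtain ⟨g, rfl⟩ := (hbij n).2 g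
        refine ⟨g, ?_⟩
        apply (hbij (n + 1)).1
        exact (G.map_comp _ _).trans hg
      · rintro ⟨g, hg⟩
        exact ⟨G.map (X := M) g, (G.map_comp _ _).symm.trans
          (congrArg (fun t : M ⟶ Y.X (n + 1) => G.map t) hg)⟩

end Comparison

end CategoryTheory

/-! ### The maps P → Hom(C, C ⊗ P) and C ⊗ Hom(C, I) → I. -/

section Modules

variable {R : Type*} [CommRing R] {C P Q I : Type*} [AddCommGroup C] [Module R C]
  [AddCommGroup P] [Module R P] [AddCommGroup Q] [Module R Q] [AddCommGroup I] [Module R I]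

/-- If all endomorphisms of the finite module `C` are homotheties, then so are all maps
`C → C ⊗ F` with `F` free. -/
lemma tensorUnit_bijective_finsupp [Module.Finite R C]
    (hC : Function.Bijective (LinearMap.lsmul R C)) (S : Type*) :
    Function.Bijective (TensorProduct.mk R C (S →₀ R)).flip := by
  classical
  let e := TensorProduct.finsuppScalarRight R R C S
  have he : ∀ (c : C) (p : S →₀ R) (s : S), e (c ⊗ₜ p) s = p s • c := fun c p s => by
    simp [e]
  constructor
  · refine (injective_iff_map_eq_zero _).2 fun p hp => ?_
    ext s
    apply hC.1
    ext c
    have h := he c p s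
    rw [show c ⊗ₜ[R] p = 0 from DFunLike.congr_fun hp c] at h
    simpa using h.symm
  · intro f
    -- Each coordinate of `f` is an endomorphism of `C`, hence multiplication by some `r s`. A
    -- nonzero `r s` moves some generator, so `s` lies in the finite union of the supports of `f` on
    -- generators.
    choose r hr using fun s => hC.2 (Finsupp.lapply s ∘ₗ e.toLinearMap ∘ₗ f)
    have hr' : ∀ s c, r s • c = e (f c) s := fun s c => DFunLike.congr_fun (hr s) c
    obtain ⟨t, ht⟩ := Module.Finite.fg_top (R := R) (M := C)
    have hsupp : ∀ s, r s ≠ 0 → s ∈ t.biUnion fun c => (e (f c)).support := by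
      intro s hs
      by_contra hn
      apply hs
      apply hC.1
      rw [map_zero]
      refine LinearMap.ext_on ht fun c hc => ?_
      simp only [Finset.mem_biUnion, Finsupp.mem_support_iff, not_exists, not_and, not_not] at hn
      simpa [hr'] using hn c hc
    refine ⟨Finsupp.onFinset _ r hsupp, ?_⟩
    ext c
    apply e.injective
    ext s
    exact (he _ _ _).trans (hr' s c)

/-- `P` is a retract of the free module `P →₀ R`, and bijectivity of a natural map passes to
retracts. -/
lemma tensorUnit_bijective [Module.Finite R C]
    (hC : Function.Bijective (LinearMap.lsmul R C)) [Module.Projective R P] :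
    Function.Bijective (TensorProduct.mk R C P).flip := by
  obtain ⟨i, hi⟩ := Module.projective_lifting_property
    (Finsupp.linearCombination R (id : P → P)) LinearMap.id
    (Finsupp.linearCombination_id_surjective R P)
  set q := Finsupp.linearCombination R (id : P → P)
  have hF := tensorUnit_bijective_finsupp hC P
  have hi' : ∀ p, q (i p) = p := fun p => DFunLike.congr_fun hi p
  constructor
  · intro x y h
    rw [← hi' x, ← hi' y]
    congr 1
    apply hF.1
    ext c
    have := congrArg (i.lTensor C) (DFunLike.congr_fun h c)
    simpa using this
  · intro f
    obtain ⟨p, hp⟩ := hF.2 (i.lTensor C ∘ₗ f)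
    refine ⟨q p, ?_⟩
    ext c
    have h := congrArg (q.lTensor C) (DFunLike.congr_fun hp c)
    have h2 : (q.lTensor C) (i.lTensor C (f c)) = f c := by
      rw [← LinearMap.comp_apply, ← LinearMap.lTensor_comp, hi, LinearMap.lTensor_id,
        LinearMap.id_apply]
    simpa [h2] using h

/-- The evaluation map `C ⊗ Hom(C, I) → I`. -/
noncomputable def tensorEval (R C I : Type*) [CommRing R] [AddCommGroup C] [Module R C]
    [AddCommGroup I] [Module R I] : C ⊗[R] (C →ₗ[R] I) →ₗ[R] I :=
  TensorProduct.lift (LinearMap.id (R := R) (M := C →ₗ[R] I)).flip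

@[simp]
lemma tensorEval_tmul (c : C) (f : C →ₗ[R] I) : tensorEval R C I (c ⊗ₜ f) = f c := rfl

end Modules

section Eval

variable {R : Type u} [CommRing R] {C I : Type u} [AddCommGroup C] [Module R C]
  [AddCommGroup I] [Module R I]

/-- After dividing by `ker f`, this is extension along an injection. -/
lemma Module.Injective.exists_factor [Module.Injective R I] {X Y : Type u} [AddCommGroup X]
    [Module R X] [AddCommGroup Y] [Module R Y] (f : X →ₗ[R] Y) (g : X →ₗ[R] I)
    (h : LinearMap.ker f ≤ LinearMap.ker g) : ∃ g' : Y →ₗ[R] I, ∀ x, g' (f x) = g x := by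
  let g₁ : (X ⧸ LinearMap.ker f) →ₗ[R] I := (LinearMap.ker f).liftQ g h
  let f₁ : (X ⧸ LinearMap.ker f) →ₗ[R] Y := (LinearMap.ker f).liftQ f le_rfl
  have hf₁ : Function.Injective f₁ :=
    LinearMap.ker_eq_bot.1 (Submodule.ker_liftQ_eq_bot _ _ _ le_rfl)
  obtain ⟨g', hg'⟩ := Module.Injective.out f₁ hf₁ g₁
  exact ⟨g', fun x => hg' (Submodule.Quotient.mk x)⟩

/-- If all endomorphisms of the finitely presented module `C` are homotheties, then
`C ⊗ Hom(C, I) → I` is bijective for every injective module `I`. -/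
lemma tensorEval_bijective [IsNoetherianRing R] [Module.Finite R C]
    (hC : Function.Bijective (LinearMap.lsmul R C)) [Module.Injective R I] :
    Function.Bijective (tensorEval R C I) := by
  classical
  obtain ⟨n, b, hb⟩ := Module.Finite.exists_fin (R := R) (M := C)
  have hext : ∀ {Z : Type u} [AddCommGroup Z] [Module R Z] {f g : C →ₗ[R] Z},
      (∀ j, f (b j) = g (b j)) → f = g := fun h =>
    LinearMap.ext_on hb (by rintro _ ⟨j, rfl⟩; exact h j)
  constructor
  · let p : (Fin n → R) →ₗ[R] C := Fintype.linearCombination R b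
    have hp : Function.Surjective p := by
      rw [← LinearMap.range_eq_top, Fintype.range_linearCombination, hb]
    obtain ⟨m, k, hk⟩ := Module.Finite.exists_fin (R := R) (M := LinearMap.ker p)
    have hk0 : ∀ l, ∑ j, (k l : Fin n → R) j • b j = 0 := fun l => (k l).2
    have hform : ∀ x : C ⊗[R] (C →ₗ[R] I), ∃ h : Fin n → (C →ₗ[R] I), x = ∑ j, b j ⊗ₜ h j := by
      intro x
      induction x using TensorProduct.induction_on with
      | zero => exact ⟨0, by simp⟩
      | tmul c f =>
        obtain ⟨r, rfl⟩ := hp c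
        refine ⟨fun j => r j • f, ?_⟩
        simp [p, Fintype.linearCombination_apply, TensorProduct.sum_tmul, TensorProduct.smul_tmul]
      | add x y hx hy =>
        obtain ⟨h, rfl⟩ := hx
        obtain ⟨h', rfl⟩ := hy
        exact ⟨h + h', by simp [TensorProduct.tmul_add, Finset.sum_add_distrib]⟩
    refine (injective_iff_map_eq_zero _).2 fun x hx => ?_
    obtain ⟨h, rfl⟩ := hform x
    have hsum : ∑ j, h j (b j) = 0 := by simpa using hx
    -- The `k l` generate the relations among the `b j`. A tuple in `ker T` satisfies these
    -- relations, so it is the image of `b` under an endomorphism of `C`, that is `r • b`. Hence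
    -- `H`, which kills `b`, kills `ker T`.
    let T : (Fin n → C) →ₗ[R] (Fin m → C) :=
      LinearMap.pi fun l => ∑ j, (k l : Fin n → R) j • LinearMap.proj j
    have hT : ∀ x l, T x l = ∑ j, (k l : Fin n → R) j • x j := fun x l => by simp [T]
    let H : (Fin n → C) →ₗ[R] I := ∑ j, h j ∘ₗ LinearMap.proj j
    have hH : ∀ x, H x = ∑ j, h j (x j) := fun x => by simp [H]
    have hTH : LinearMap.ker T ≤ LinearMap.ker H := by
      intro x hx
      let q : (Fin n → R) →ₗ[R] C := Fintype.linearCombination R x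
      have hpq : LinearMap.ker p ≤ LinearMap.ker q := by
        have hq : q ∘ₗ (LinearMap.ker p).subtype = 0 := by
          refine LinearMap.ext_on hk ?_
          rintro _ ⟨l, rfl⟩
          exact (hT x l).symm.trans (congrFun hx l)
        exact fun y hy => show q y = 0 from DFunLike.congr_fun hq (⟨y, hy⟩ : LinearMap.ker p)
      let f : C →ₗ[R] C := (LinearMap.ker p).liftQ q hpq ∘ₗ
        (p.quotKerEquivOfSurjective hp).symm.toLinearMap
      have hf : ∀ y, f (p y) = q y := fun y => by
        have : (p.quotKerEquivOfSurjective hp).symm (p y) = (LinearMap.ker p).mkQ y := by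
          rw [LinearEquiv.symm_apply_eq]
          rfl
        simp [f, this]
      obtain ⟨r, hr⟩ := hC.2 f
      have hx' : ∀ j, x j = r • b j := fun j => by
        have h1 := hf (Pi.single j 1)
        rw [← hr] at h1
        simpa [p, q, Fintype.linearCombination_apply_single] using h1.symm
      rw [LinearMap.mem_ker, hH]
      simp [hx', ← Finset.smul_sum, hsum]
    -- Writing `H = G ∘ T` expresses each `h j` through the relations. Moving these coefficients
    -- across the tensor sign leaves the sums `∑ j, k l j • b j = 0`.
    obtain ⟨G, hG⟩ := Module.Injective.exists_factor T H hTH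
    have hh : ∀ j, h j = ∑ l, (k l : Fin n → R) j • (G ∘ₗ LinearMap.single R (fun _ => C) l) := by
      intro j
      ext c
      have h1 : H (Pi.single j c) = h j c := by
        rw [hH, Finset.sum_eq_single j (fun i _ hi => by simp [hi]) (by simp)]
        simp
      have h2 : T (Pi.single j c) = ∑ l, Pi.single l ((k l : Fin n → R) j • c) := by
        rw [Finset.univ_sum_single]
        ext l
        rw [hT, Finset.sum_eq_single j (fun i _ hi => by simp [hi]) (by simp)]
        simp
      rw [← h1, ← hG, h2, map_sum]
      simp [LinearMap.sum_apply, ← map_smul, ← Pi.single_smul]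
    simp only [hh, TensorProduct.tmul_sum, TensorProduct.tmul_smul]
    rw [Finset.sum_comm]
    refine Finset.sum_eq_zero fun l _ => ?_
    simp only [TensorProduct.smul_tmul', ← TensorProduct.sum_tmul, hk0, TensorProduct.zero_tmul]
  · intro i
    -- Faithfulness of `C` makes `1 ↦ b` injective, so `1 ↦ i` extends to `C ^ n`; the components of
    -- the extension give the preimage of `i`.
    let φ : R →ₗ[R] (Fin n → C) := LinearMap.pi fun j => LinearMap.toSpanSingleton R C (b j)
    have hφ : Function.Injective φ := by
      refine (injective_iff_map_eq_zero _).2 fun r hr => ?_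
      apply hC.1
      rw [map_zero]
      exact hext fun j => congrFun hr j
    obtain ⟨g, hg⟩ := Module.Injective.out φ hφ (LinearMap.toSpanSingleton R I i)
    refine ⟨∑ j, b j ⊗ₜ (g ∘ₗ LinearMap.single R (fun _ => C) j), ?_⟩
    have h1 := hg 1
    rw [LinearMap.toSpanSingleton_apply, one_smul] at h1
    rw [← h1, map_sum]
    simp only [tensorEval_tmul, LinearMap.comp_apply, LinearMap.single_apply]
    rw [← map_sum, Finset.univ_sum_single]
    congr 1
    ext j
    simp [φ]

end Eval

/-! ### Relative Ext as ordinary Ext after Hom(C, -) or C ⊗ -. -/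

namespace SemidualizingBalance

variable {R : Type u} [CommRing R]

instance (C : ModuleCat.{u} R) : (homFunctor C).Linear R where

/-- `Hom_R(C, X)` is projective for `C`-projective `X`, since `Hom_R(C, C ⊗ P) ≅ P`. -/
lemma projective_homFunctor_obj {C X : ModuleCat.{u} R} [Module.Finite R C]
    (hC : Function.Bijective (LinearMap.lsmul R C)) (hX : IsCProjective C X) :
    Projective ((homFunctor C).obj X) := by
  obtain ⟨P, hP, ⟨e⟩⟩ := hX
  let e' : P ≃ₗ[R] ((homFunctor C).obj X) :=
    LinearEquiv.ofBijective _ (tensorUnit_bijective hC) ≪≫ₗ e.symm.congrRight ≪≫ₗ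
      ModuleCat.homLinearEquiv.symm
  rw [← IsProjective.iff_projective]
  exact Module.Projective.of_equiv e'

/-- With X = C ⊗ P, adjunction gives Hom(X, N) ≅ Hom(P, Hom(C, N)), and P ≅ Hom(C, X) by
`tensorUnit_bijective`. -/
lemma homFunctor_map_bijective {C X : ModuleCat.{u} R} [Module.Finite R C]
    (hC : Function.Bijective (LinearMap.lsmul R C)) (hX : IsCProjective C X)
    (N : ModuleCat.{u} R) :
    Function.Bijective ((homFunctor C).map :
      (X ⟶ N) → ((homFunctor C).obj X ⟶ (homFunctor C).obj N)) := by
  obtain ⟨P, hP, ⟨e⟩⟩ := hX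
  let u : P →ₗ[R] (C →ₗ[R] X) := (TensorProduct.mk R C P).flip.compr₂ e.symm.toLinearMap
  have hu : ∀ p c, u p c = e.symm (c ⊗ₜ p) := fun p c => rfl
  constructor
  · intro f g h
    have : f.hom ∘ₗ e.symm.toLinearMap = g.hom ∘ₗ e.symm.toLinearMap := by
      refine TensorProduct.ext' fun c p => ?_
      have h1 : ModuleCat.ofHom (u p) ≫ f = ModuleCat.ofHom (u p) ≫ g :=
        congrArg (fun F : (homFunctor C).obj X ⟶ (homFunctor C).obj N =>
          F.hom (ModuleCat.ofHom (u p))) h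
      exact congrArg (fun F : C ⟶ N => F.hom c) h1
    ext x
    simpa using DFunLike.congr_fun this (e x)
  · intro F
    let F' : (C →ₗ[R] X) →ₗ[R] (C →ₗ[R] N) :=
      ModuleCat.homLinearEquiv.toLinearMap ∘ₗ F.hom ∘ₗ
        (ModuleCat.homLinearEquiv (S := R) (M := C) (N := X)).symm.toLinearMap
    refine ⟨ModuleCat.ofHom (TensorProduct.lift (F' ∘ₗ u).flip ∘ₗ e.toLinearMap), ?_⟩
    apply ModuleCat.hom_ext
    refine LinearMap.ext fun (h : C ⟶ X) => ?_
    obtain ⟨p, hp⟩ := (tensorUnit_bijective hC (P := P)).2 (e.toLinearMap ∘ₗ h.hom)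
    have hp' : ∀ c, e (h.hom c) = c ⊗ₜ p := fun c => (DFunLike.congr_fun hp c).symm
    have hup : u p = h.hom := by
      ext c
      rw [hu, ← hp', e.symm_apply_apply]
    apply ModuleCat.hom_ext
    ext c
    change TensorProduct.lift (F' ∘ₗ u).flip (e (h.hom c)) = F' h.hom c
    rw [hp', TensorProduct.lift.tmul, ← hup]
    rfl

/-- `C ⊗ Y` is injective for `C`-injective `Y`, since `C ⊗ Hom_R(C, I) ≅ I`. -/
lemma injective_tensorLeft_obj [IsNoetherianRing R] {C Y : ModuleCat.{u} R} [Module.Finite R C]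
    (hC : Function.Bijective (LinearMap.lsmul R C)) (hY : IsCInjective C Y) :
    Injective ((tensorLeft C).obj Y) := by
  obtain ⟨I, hI, ⟨e⟩⟩ := hY
  let e' : C ⊗[R] Y ≃ₗ[R] I :=
    e.lTensor C ≪≫ₗ LinearEquiv.ofBijective _ (tensorEval_bijective hC)
  have : Injective I := (Module.injective_iff_injective_object R I).1 hI
  exact Injective.of_iso (LinearEquiv.toModuleIso e').symm this

/-- With Y = Hom(C, I), evaluation gives C ⊗ Y ≅ I, so Hom(C ⊗ M, C ⊗ Y) ≅ Hom(C ⊗ M, I) ≅ Hom(M, Y)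
by adjunction. -/
lemma tensorLeft_map_bijective [IsNoetherianRing R] {C Y : ModuleCat.{u} R} [Module.Finite R C]
    (hC : Function.Bijective (LinearMap.lsmul R C)) (hY : IsCInjective C Y)
    (M : ModuleCat.{u} R) :
    Function.Bijective ((tensorLeft C).map :
      (M ⟶ Y) → ((tensorLeft C).obj M ⟶ (tensorLeft C).obj Y)) := by
  obtain ⟨I, hI, ⟨e⟩⟩ := hY
  have hev := tensorEval_bijective hC (I := I)
  let v : C ⊗[R] Y →ₗ[R] I := tensorEval R C I ∘ₗ e.toLinearMap.lTensor C
  have hv : ∀ c y, v (c ⊗ₜ y) = e y c := fun c y => rfl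
  have hvi : Function.Injective v := hev.1.comp (e.lTensor C).injective
  constructor
  · intro f g h
    ext m
    apply e.injective
    ext c
    exact congrArg (fun F : (tensorLeft C).obj M ⟶ (tensorLeft C).obj Y => v (F.hom (c ⊗ₜ m))) h
  · intro F
    let F' : C ⊗[R] M →ₗ[R] C ⊗[R] Y := F.hom
    let f : M →ₗ[R] Y := e.symm.toLinearMap ∘ₗ (TensorProduct.curry (v ∘ₗ F')).flip
    refine ⟨ModuleCat.ofHom f, ?_⟩
    apply ModuleCat.hom_ext
    refine TensorProduct.ext' fun c m => ?_
    apply hvi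
    change v (c ⊗ₜ f m) = v (F' (c ⊗ₜ m))
    rw [hv]
    simp [f]

/-- `Ext_{𝒫_C}(M, N) ≅ Ext_R(Hom(C, M), Hom(C, N))`. -/
theorem extProj_equiv_ext {C : ModuleCat.{u} R} (hC : IsSemidualizing C) (M N : ModuleCat.{u} R)
    (i : ℕ) : Nonempty (ExtProj C M N i ≃ₗ[R]
      Abelian.Ext ((homFunctor C).obj M) ((homFunctor C).obj N) i) :=
  have := hC.finite
  let L := properProjRes C M
  linearYonedaObj_homology_equiv_ext (homFunctor C) L.complex M N L.ε L.d_comp_ε L.acyclic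
    (fun n => projective_homFunctor_obj hC.homothety (L.isCProjective n))
    (fun n => homFunctor_map_bijective hC.homothety (L.isCProjective n) N) i

/-- `Ext_{ℐ_C}(M, N) ≅ Ext_R(C ⊗ M, C ⊗ N)`. -/
theorem extInj_equiv_ext [IsNoetherianRing R] {C : ModuleCat.{u} R} (hC : IsSemidualizing C)
    (M N : ModuleCat.{u} R) (i : ℕ) : Nonempty (ExtInj C M N i ≃ₗ[R]
      Abelian.Ext ((tensorLeft C).obj M) ((tensorLeft C).obj N) i) :=
  have := hC.finite
  let J := properInjRes C N
  linearCoyoneda_homology_equiv_ext (tensorLeft C) J.complex M N J.η J.η_comp_d J.acyclic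
    (fun n => injective_tensorLeft_obj hC.homothety (J.isCInjective n))
    (fun n => tensorLeft_map_bijective hC.homothety (J.isCInjective n) M) i

end SemidualizingBalance

/-! ### Invertible modules. -/

section Invertible

variable {R M : Type*} [CommRing R] [AddCommGroup M] [Module R M]

/-- A finitely generated projective module all of whose endomorphisms are homotheties is
invertible. -/
lemma Module.Invertible.of_lsmul_bijective [Module.Finite R M] [Module.Projective R M]
    (hM : Function.Bijective (LinearMap.lsmul R M)) : Module.Invertible R M :=
  Module.Invertible.right
    (dualTensorHomEquiv R M M ≪≫ₗ (LinearEquiv.ofBijective _ hM).symm)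

lemma Module.Invertible.rankAtStalk_eq_one [Module.Invertible R M] (p : PrimeSpectrum R) :
    Module.rankAtStalk M p = 1 := by
  have : Nontrivial R := p.nontrivial
  have h := congrFun (Module.rankAtStalk_eq_of_equiv (R := R) (M := Module.Dual R M ⊗[R] M) (N := R)
    (Module.Invertible.linearEquiv R M)) p
  rw [Module.rankAtStalk_tensorProduct, Module.rankAtStalk_self] at h
  exact Nat.eq_one_of_mul_eq_one_left h

end Invertible

/-! ### Projectivity criteria at maximal ideals. -/

section Local

variable {R M : Type*} [CommRing R] [AddCommGroup M] [Module R M]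

/-- If the fiber of a finite module `M` at the maximal ideal `m` is one-dimensional,
then `M` is cyclic on a neighborhood of `m`. -/
lemma exists_smul_mem_span_singleton [Module.Finite R M] (m : Ideal R) [hm : m.IsMaximal]
    (h : Module.finrank (R ⧸ m) ((R ⧸ m) ⊗[R] M) = 1) :
    ∃ x : M, ∃ r ∉ m, ∀ y : M, r • y ∈ Submodule.span R {x} := by
  let _ : Field (R ⧸ m) := Ideal.Quotient.field m
  obtain ⟨v, hv0, hv⟩ := finrank_eq_one_iff'.1 h
  have hsurj : Function.Surjective (TensorProduct.mk R (R ⧸ m) M 1) :=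
    TensorProduct.mk_surjective R M (R ⧸ m) Ideal.Quotient.mk_surjective
  obtain ⟨x, rfl⟩ := hsurj v
  have hker : ∀ z : M, (1 : R ⧸ m) ⊗ₜ[R] z = 0 → z ∈ m • (⊤ : Submodule R M) := fun z hz => by
    have h1 := congrArg (TensorProduct.quotTensorEquivQuotSMul M m) hz
    rw [← map_one (Ideal.Quotient.mk m), TensorProduct.quotTensorEquivQuotSMul_mk_tmul, map_zero,
      one_smul, Submodule.Quotient.mk_eq_zero] at h1
    exact h1
  let N := Submodule.span R {x}
  -- A lift `x` of a basis vector of the fiber spans `M` modulo `m • M`. Nakayama then yields `r ≡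
  -- 1` modulo `m` that kills `M ⧸ N`.
  have hN : (⊤ : Submodule R (M ⧸ N)) ≤ m • ⊤ := by
    rintro z -
    obtain ⟨y, rfl⟩ := N.mkQ_surjective z
    obtain ⟨a, ha⟩ := hv (1 ⊗ₜ y)
    obtain ⟨a, rfl⟩ := Ideal.Quotient.mk_surjective a
    have h1 : y - a • x ∈ m • (⊤ : Submodule R M) := by
      apply hker
      rw [TensorProduct.tmul_sub, ← ha, TensorProduct.tmul_smul, sub_eq_zero]
      exact (algebraMap_smul (R ⧸ m) a _)
    have h2 : N.mkQ y = N.mkQ (y - a • x) := by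
      rw [map_sub, eq_comm, sub_eq_self, Submodule.mkQ_apply, Submodule.Quotient.mk_eq_zero]
      exact N.smul_mem a (Submodule.mem_span_singleton_self x)
    rw [h2]
    have h3 := Submodule.mem_map_of_mem (f := N.mkQ) h1
    rw [Submodule.map_smul''] at h3
    exact Submodule.smul_mono le_rfl le_top h3
  obtain ⟨r, hr, hr0⟩ := Submodule.exists_sub_one_mem_and_smul_eq_zero_of_fg_of_le_smul m _
    (Module.Finite.fg_top (R := R) (M := M ⧸ N)) hN
  refine ⟨x, r, fun hrm => hm.ne_top (m.eq_top_of_isUnit_mem ?_ isUnit_one), fun y => ?_⟩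
  · simpa using m.sub_mem hrm hr
  · rw [← Submodule.Quotient.mk_eq_zero, Submodule.Quotient.mk_smul]
    exact hr0 _ trivial

/-- A finite faithful module over a Noetherian ring all of whose fibers at maximal ideals are
one-dimensional is projective. -/
lemma Module.Projective.of_finrank_fiber_eq_one [IsNoetherianRing R] [Module.Finite R M]
    (hM : Function.Injective (LinearMap.lsmul R M))
    (h : ∀ (m : Ideal R), m.IsMaximal → Module.finrank (R ⧸ m) ((R ⧸ m) ⊗[R] M) = 1) :
    Module.Projective R M := by
  have := Module.finitePresentation_of_finite R M
  refine Module.projective_of_localization_maximal fun m hm => ?_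
  obtain ⟨x, r, hrm, hr⟩ := exists_smul_mem_span_singleton m (h m hm)
  let f := LinearMap.toSpanSingleton (Localization.AtPrime m) _
    (LocalizedModule.mk x (1 : m.primeCompl))
  have hf : ∀ a s, f (Localization.mk a s) = LocalizedModule.mk (a • x) s := fun a s => by
    simp [f, LocalizedModule.mk_smul_mk]
  refine Module.Projective.of_equiv (LinearEquiv.ofBijective f ⟨?_, ?_⟩)
  · refine (injective_iff_map_eq_zero _).2 fun z hz => ?_
    induction z using Localization.induction_on with
    | H z =>
      obtain ⟨a, s⟩ := z
      rw [hf, ← LocalizedModule.zero_mk s, LocalizedModule.mk_eq] at hz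
      obtain ⟨t, ht⟩ := hz
      -- Since `r • M` lies in the span of `x` and `t * s * a` kills `x`, the product kills the
      -- faithful module `M`. As `r` and `t` are outside `m`, the fraction `a / s` vanishes.
      have h0 : (t * s * a * r : R) = 0 := by
        apply hM
        rw [map_zero]
        ext y
        obtain ⟨b, hb⟩ := Submodule.mem_span_singleton.1 (hr y)
        have ht' : (t : R) • (s : R) • a • x = 0 := by simpa [Submonoid.smul_def] using ht
        rw [LinearMap.lsmul_apply, mul_smul, ← hb, smul_comm, mul_smul, mul_smul, ht', smul_zero,
          LinearMap.zero_apply]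
      rw [← Localization.mk_zero s, Localization.mk_eq_mk_iff, Localization.r_iff_exists]
      refine ⟨t * ⟨r, hrm⟩, ?_⟩
      simp only [Submonoid.coe_mul, mul_zero]
      linear_combination h0
  · intro z
    induction z using LocalizedModule.induction_on with
    | h y s =>
      obtain ⟨a, ha⟩ := Submodule.mem_span_singleton.1 (hr y)
      refine ⟨Localization.mk a (⟨r, hrm⟩ * s), ?_⟩
      rw [hf, ha]
      exact LocalizedModule.mk_cancel_common_left ⟨r, hrm⟩ s y

/-- A cokernel `P` of `f : K → F` with `F` finite free is projective if all maps from `K` to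
residue fields extend along `f`. -/
lemma Module.Projective.of_forall_exists_extend {K F P : Type*} [IsNoetherianRing R]
    [AddCommGroup K] [Module R K] [AddCommGroup F] [Module R F] [AddCommGroup P] [Module R P]
    [Module.Finite R K] [Module.Finite R F] [Module.Free R F]
    (f : K →ₗ[R] F) (g : F →ₗ[R] P) (hg : Function.Surjective g) (hfg : Function.Exact f g)
    (h : ∀ (m : Ideal R), m.IsMaximal → ∀ φ : K →ₗ[R] R ⧸ m, ∃ φ' : F →ₗ[R] R ⧸ m, φ' ∘ₗ f = φ) :
    Module.Projective R P := by
  have := Module.Finite.of_surjective g hg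
  have := Module.finitePresentation_of_finite R P
  refine Module.projective_of_localization_maximal fun m hm => ?_
  let A := Localization.AtPrime m
  let S := m.primeCompl
  let κ := IsLocalRing.ResidueField A
  have : Module.Free A (LocalizedModule S F) :=
    Module.free_of_isLocalizedModule S (LocalizedModule.mkLinearMap S F)
  -- As `R ⧸ m` is already the residue field of `A`, maps from `K` to `R ⧸ m` are the same as
  -- `A`-linear maps from the localization of `K` to `κ`.
  let e : (R ⧸ m) ≃ₗ[R] κ :=
    LinearEquiv.ofBijective (IsScalarTower.toAlgHom R (R ⧸ m) m.ResidueField).toLinearMap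
      m.bijective_algebraMap_quotient_residueField
  have hunit : ∀ x : S, IsUnit (algebraMap R (Module.End R κ) x) := fun x => by
    have hx : IsUnit (algebraMap R κ x) := by
      rw [IsScalarTower.algebraMap_apply R A κ]
      exact (IsLocalization.map_units A x).map _
    rw [Module.End.isUnit_iff]
    have hb := hx.unit.mulLeft_bijective
    convert hb using 1
    ext y
    simp [Algebra.smul_def]
  suffices Module.Free A (LocalizedModule S P) from inferInstance
  refine Module.free_of_lTensor_residueField_injective (LocalizedModule.map S f)
    (LocalizedModule.map S g) (LocalizedModule.map_surjective S g hg)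
    (LocalizedModule.map_exact S f g hfg) ?_
  refine (injective_iff_map_eq_zero _).2 fun z hz => ?_
  -- Injectivity over `κ` is tested on functionals: every `ψ` factors through the base change of
  -- `f`, so it vanishes on the kernel.
  refine (Module.forall_dual_apply_eq_zero_iff κ z).1 fun ψ => ?_
  let ψ₁ : LocalizedModule S K →ₗ[A] κ := ψ.restrictScalars A ∘ₗ TensorProduct.mk A κ _ 1
  obtain ⟨φ', hφ'⟩ := h m hm
    (e.symm.toLinearMap ∘ₗ ψ₁.restrictScalars R ∘ₗ LocalizedModule.mkLinearMap S K)
  let G : LocalizedModule S F →ₗ[A] κ :=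
    (LocalizedModule.lift S (e.toLinearMap ∘ₗ φ') hunit).extendScalarsOfIsLocalization S A
  have hG : G ∘ₗ LocalizedModule.map S f = ψ₁ := by
    apply LinearMap.restrictScalars_injective R
    refine IsLocalizedModule.ext S (LocalizedModule.mkLinearMap S K) hunit ?_
    ext k
    have h1 : G (LocalizedModule.mkLinearMap S F (f k)) = e (φ' (f k)) :=
      DFunLike.congr_fun (LocalizedModule.lift_comp S (e.toLinearMap ∘ₗ φ') hunit) (f k)
    have h2 := congrArg e (DFunLike.congr_fun hφ' k)
    simp only [LinearMap.comp_apply, LinearEquiv.coe_coe, LinearEquiv.apply_symm_apply] at h2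
    simp only [LinearMap.comp_apply, LinearMap.restrictScalars_apply,
      LocalizedModule.mkLinearMap_apply] at h1 h2 ⊢
    rw [← h2, ← h1]
    exact congrArg G (LocalizedModule.map_mk S f k 1)
  have hψ : ψ = (LinearMap.liftBaseChange κ G) ∘ₗ (LocalizedModule.map S f).baseChange κ := by
    apply (LinearMap.liftBaseChangeEquiv κ).symm.injective
    ext k
    refine (DFunLike.congr_fun hG k).symm.trans ?_
    exact (one_smul κ _).symm
  rw [hψ, LinearMap.comp_apply]
  exact (congrArg _ hz).trans (map_zero _)

end Local

section Ext

variable {R : Type u} [CommRing R]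

/-- A finite module `M` over a Noetherian ring is projective if `Ext¹(M, R ⧸ m) = 0` for all
maximal ideals `m`. -/
lemma Module.Projective.of_subsingleton_ext_one [IsNoetherianRing R] (M : ModuleCat.{u} R)
    [Module.Finite R M]
    (h : ∀ m : Ideal R, m.IsMaximal → Subsingleton (Abelian.Ext M (ModuleCat.of R (R ⧸ m)) 1)) :
    Module.Projective R M := by
  obtain ⟨n, g, hg⟩ := Module.Finite.exists_fin' R M
  refine Module.Projective.of_forall_exists_extend (LinearMap.ker g).subtype g hg
    (LinearMap.exact_subtype_ker_map g) fun m hm φ => ?_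
  have := h m hm
  -- The obstruction to extending `φ` from `ker g` to the free module is its connecting image in
  -- Ext¹(M, R ⧸ m), which is zero.
  obtain ⟨x, hx⟩ := Abelian.Ext.contravariant_sequence_exact₁
    (LinearMap.shortExact_shortComplexKer hg) _
    (Abelian.Ext.mk₀ (ModuleCat.ofHom φ :
      ModuleCat.of R (LinearMap.ker g) ⟶ ModuleCat.of R (R ⧸ m))) (add_zero 1)
    (Subsingleton.elim _ _)
  obtain ⟨φ', rfl⟩ := (Abelian.Ext.mk₀_bijective _ _).2 x
  rw [Abelian.Ext.mk₀_comp_mk₀] at hx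
  exact ⟨φ'.hom, congrArg ModuleCat.Hom.hom ((Abelian.Ext.mk₀_bijective _ _).1 hx)⟩

end Ext

/-! ### Fiber dimensions at a maximal ideal. -/

section Fiber

variable {R : Type*} [CommRing R]

/-- The dimension of the fiber `(R ⧸ m) ⊗ M`. -/
noncomputable def fiberRank (m : Ideal R) (M : Type*) [AddCommGroup M] [Module R M] : ℕ :=
  Module.finrank (R ⧸ m) ((R ⧸ m) ⊗[R] M)

variable (m : Ideal R) {M N V : Type*} [AddCommGroup M] [Module R M]
  [AddCommGroup N] [Module R N] [AddCommGroup V] [Module R V] [Module (R ⧸ m) V]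
  [IsScalarTower R (R ⧸ m) V]

lemma fiberRank_congr (e : M ≃ₗ[R] N) : fiberRank m M = fiberRank m N :=
  (e.baseChange R (R ⧸ m) M N).finrank_eq

lemma fiberRank_self [hm : m.IsMaximal] : fiberRank m R = 1 := by
  let _ : Field (R ⧸ m) := Ideal.Quotient.field m
  exact (AlgebraTensorModule.rid R (R ⧸ m) (R ⧸ m)).finrank_eq.trans (Module.finrank_self _)

lemma fiberRank_tensorProduct [m.IsMaximal] :
    fiberRank m (M ⊗[R] N) = fiberRank m M * fiberRank m N := by
  let _ : Field (R ⧸ m) := Ideal.Quotient.field m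
  exact (AlgebraTensorModule.distribBaseChange R (R ⧸ m) M N).finrank_eq.trans
    (Module.finrank_tensorProduct ..)

lemma finrank_linearMap_fiber [m.IsMaximal] [Module.Finite R M] :
    Module.finrank (R ⧸ m) (M →ₗ[R] V) = fiberRank m M * Module.finrank (R ⧸ m) V := by
  let _ : Field (R ⧸ m) := Ideal.Quotient.field m
  rw [(LinearMap.liftBaseChangeEquiv (R ⧸ m) (R := R) (M := M) (N := V)).finrank_eq]
  exact Module.finrank_linearMap ..

/-- Since R → R ⧸ m is onto, `e` is automatically linear over `R ⧸ m`. This lets a bare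
`R`-isomorphism of Ext modules be read as an equality of dimensions. -/
lemma finrank_eq_of_linearEquiv {V W : Type*} [AddCommMonoid V] [Module R V] [Module (R ⧸ m) V]
    [IsScalarTower R (R ⧸ m) V] [AddCommMonoid W] [Module R W] [Module (R ⧸ m) W]
    [IsScalarTower R (R ⧸ m) W] (e : V ≃ₗ[R] W) :
    Module.finrank (R ⧸ m) V = Module.finrank (R ⧸ m) W :=
  (e.extendScalarsOfSurjective (S := R ⧸ m) Ideal.Quotient.mk_surjective).finrank_eq

/-- Nakayama: if M = mM, some `r ≡ 1` modulo `m` kills `M`; faithfulness forces `r = 0`, hence `1 ∈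
m`. -/
lemma fiberRank_ne_zero [hm : m.IsMaximal] [Module.Finite R M]
    (hM : Function.Injective (LinearMap.lsmul R M)) : fiberRank m M ≠ 0 := by
  let _ : Field (R ⧸ m) := Ideal.Quotient.field m
  intro h0
  have h1 : Subsingleton ((R ⧸ m) ⊗[R] M) := Module.finrank_zero_iff.1 h0
  have h2 : Subsingleton (M ⧸ m • (⊤ : Submodule R M)) :=
    (TensorProduct.quotTensorEquivQuotSMul M m).symm.injective.subsingleton
  rw [Submodule.Quotient.subsingleton_iff] at h2
  obtain ⟨r, hr, hr0⟩ := Submodule.exists_sub_one_mem_and_smul_eq_zero_of_fg_of_le_smul m _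
    (Module.Finite.fg_top (R := R) (M := M)) h2.ge
  have : r = 0 := hM (by ext x; simpa using hr0 x trivial)
  subst this
  refine hm.ne_top (m.eq_top_of_isUnit_mem hr ?_)
  simp

end Fiber

/-! ### The invertible case: proper resolutions are ordinary resolutions. -/

namespace SemidualizingBalance

variable {R : Type u} [CommRing R]

section Invertible

/-- For `x` in the kernel, each map `c ↦ φ c • x` lifts along `S.f`, so every `φ c • x` is a
boundary. Invertibility writes 1 as a sum of such values `φ c`. -/
lemma exact_of_exact_homFunctor (C : ModuleCat.{u} R) [Module.Invertible R C]
    (S : ShortComplex (ModuleCat.{u} R)) (h : (S.map (homFunctor C)).Exact) : S.Exact := by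
  rw [ShortComplex.moduleCat_exact_iff] at h ⊢
  intro x hx
  suffices ∀ (z : Module.Dual R C ⊗[R] C), ∃ y, S.f.hom y = contractLeft R C z • x by
    obtain ⟨y, hy⟩ := this ((Module.Invertible.linearEquiv R C).symm 1)
    refine ⟨y, hy.trans ?_⟩
    rw [show contractLeft R C _ = 1 from
      (Module.Invertible.linearEquiv R C).apply_symm_apply 1, one_smul]
  intro z
  induction z using TensorProduct.induction_on with
  | zero => exact ⟨0, by simp⟩
  | add z w hz hw =>
    obtain ⟨y, hy⟩ := hz
    obtain ⟨y', hy'⟩ := hw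
    exact ⟨y + y', by rw [map_add, map_add, hy, hy', add_smul]⟩
  | tmul φ c =>
    let g : C ⟶ S.X₂ := ModuleCat.ofHom ((LinearMap.toSpanSingleton R _ x) ∘ₗ φ)
    have hg : g ≫ S.g = 0 := by
      ext c
      change S.g.hom (φ c • x) = 0
      rw [map_smul, hx, smul_zero]
    obtain ⟨k, hk⟩ := h g hg
    exact ⟨k.hom c, congrArg (fun F : C ⟶ S.X₂ => F.hom c) hk⟩

/-- Tensoring with the dual recovers `N` from `C ⊗ N`, so `C ⊗ N = 0` forces `N = 0`. -/
lemma faithfullyFlat_of_invertible (C : Type u) [AddCommGroup C] [Module R C]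
    [Module.Invertible R C] : Module.FaithfullyFlat R C := by
  rw [Module.FaithfullyFlat.iff_flat_and_lTensor_faithful]
  refine ⟨inferInstance, fun N _ _ hN => ?_⟩
  by_contra hn
  rw [not_nontrivial_iff_subsingleton] at hn
  have : Subsingleton N :=
    (Module.Invertible.leftCancelEquiv N
      (Module.Invertible.linearEquiv R C)).symm.injective.subsingleton
  exact not_subsingleton N this

lemma exact_of_exact_tensorLeft (C : ModuleCat.{u} R) [Module.Invertible R C]
    (S : ShortComplex (ModuleCat.{u} R)) (h : (S.map (tensorLeft C)).Exact) : S.Exact := by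
  have := faithfullyFlat_of_invertible (R := R) C
  rw [ShortComplex.ShortExact.moduleCat_exact_iff_function_exact] at h ⊢
  exact (Module.FaithfullyFlat.lTensor_exact_iff_exact R C S.f.hom S.g.hom).1 h

/-- Hom(C, -) is right adjoint to the exact functor C ⊗ -, so it preserves injectives. -/
lemma injective_of_isCInjective {C Y : ModuleCat.{u} R} [Module.Flat R C]
    (hY : IsCInjective C Y) : Injective Y := by
  obtain ⟨I, hI, ⟨e⟩⟩ := hY
  have hI' : Injective I := (Module.injective_iff_injective_object R I).1 hI
  have : Injective ((ihom C).obj I) := (ihom.adjunction C).map_injective I hI'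
  exact Injective.of_iso (LinearEquiv.toModuleIso (e ≪≫ₗ ModuleCat.homLinearEquiv.symm)).symm this

/-- For invertible `C`, `𝒫_C`-projective resolutions compute `Ext`. -/
theorem extProj_equiv_ext_of_invertible (C : ModuleCat.{u} R) [Module.Invertible R C]
    (M N : ModuleCat.{u} R) (i : ℕ) : Nonempty (ExtProj C M N i ≃ₗ[R] Abelian.Ext M N i) :=
  let L := properProjRes C M
  -- The comparison functor is the identity: the proper resolution is itself exact, with projective
  -- terms C ⊗ P.
  linearYonedaObj_homology_equiv_ext (𝟭 _) L.complex M N L.ε L.d_comp_ε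
    (fun n => exact_of_exact_homFunctor C _ (L.acyclic n))
    (fun n => by
      obtain ⟨P, hP, ⟨e⟩⟩ := L.isCProjective n
      exact (IsProjective.iff_projective _).1 (Module.Projective.of_equiv e.symm))
    (fun _ => Function.bijective_id) i

/-- For invertible `C`, `ℐ_C`-injective resolutions compute `Ext`. -/
theorem extInj_equiv_ext_of_invertible (C : ModuleCat.{u} R) [Module.Invertible R C]
    (M N : ModuleCat.{u} R) (i : ℕ) : Nonempty (ExtInj C M N i ≃ₗ[R] Abelian.Ext M N i) :=
  let J := properInjRes C N
  linearCoyoneda_homology_equiv_ext (𝟭 _) J.complex M N J.η J.η_comp_d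
    (fun n => exact_of_exact_tensorLeft C _ (J.acyclic n))
    (fun n => injective_of_isCInjective (J.isCInjective n))
    (fun _ => Function.bijective_id) i

end Invertible

lemma IsSemidualizing.invertible {C : ModuleCat.{u} R} (hC : IsSemidualizing C)
    (h : Module.Projective R C) : Module.Invertible R C :=
  have := hC.finite
  Module.Invertible.of_lsmul_bijective hC.homothety

lemma isPicard_of_invertible (C : ModuleCat.{u} R) [Module.Invertible R C] : IsPicard C :=
  ⟨inferInstance, inferInstance, Module.Invertible.rankAtStalk_eq_one⟩

lemma extProj_zero_equiv {C : ModuleCat.{u} R} (hC : IsSemidualizing C) (M N : ModuleCat.{u} R) :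
    Nonempty (ExtProj C M N 0 ≃ₗ[R] ((C →ₗ[R] M) →ₗ[R] (C →ₗ[R] N))) := by
  obtain ⟨e⟩ := extProj_equiv_ext hC M N 0
  exact ⟨e ≪≫ₗ Abelian.Ext.linearEquiv₀ ≪≫ₗ ModuleCat.homLinearEquiv ≪≫ₗ
    LinearEquiv.arrowCongr ModuleCat.homLinearEquiv ModuleCat.homLinearEquiv⟩

lemma extInj_zero_equiv [IsNoetherianRing R] {C : ModuleCat.{u} R} (hC : IsSemidualizing C)
    (M N : ModuleCat.{u} R) : Nonempty (ExtInj C M N 0 ≃ₗ[R] (C ⊗[R] M →ₗ[R] C ⊗[R] N)) := by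
  obtain ⟨e⟩ := extInj_equiv_ext hC M N 0
  exact ⟨e ≪≫ₗ Abelian.Ext.linearEquiv₀ ≪≫ₗ ModuleCat.homLinearEquiv⟩

/-- C ≅ C ⊗ R is itself `C`-projective, so Hom(C, C) is projective and its Ext¹ vanishes. -/
lemma subsingleton_extProj_self_one {C : ModuleCat.{u} R} (hC : IsSemidualizing C)
    (N : ModuleCat.{u} R) : Subsingleton (ExtProj C C N 1) := by
  have := hC.finite
  have hproj : Projective ((homFunctor C).obj C) :=
    projective_homFunctor_obj hC.homothety
      ⟨ModuleCat.of R R, inferInstanceAs (Module.Projective R R), ⟨(TensorProduct.rid R C).symm⟩⟩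
  have := Abelian.Ext.subsingleton_of_projective ((homFunctor C).obj C) ((homFunctor C).obj N) 0
  obtain ⟨e⟩ := extProj_equiv_ext hC C N 1
  exact e.injective.subsingleton

/-! ### Numerical consequences of an isomorphism in degree zero. -/

variable [IsNoetherianRing R] {B C : ModuleCat.{u} R}

/-- The two sides are the dimensions over k = R ⧸ m of Hom(Hom(C, M), Hom(C, k)) and Hom(B ⊗ M, B ⊗
k). -/
lemma fiberRank_eq_of_extZero_equiv (hB : IsSemidualizing B) (hC : IsSemidualizing C)
    (M : ModuleCat.{u} R) [Module.Finite R M] (m : Ideal R) [m.IsMaximal]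
    (h : Nonempty (ExtProj C M (ModuleCat.of R (R ⧸ m)) 0 ≃ₗ[R]
      ExtInj B M (ModuleCat.of R (R ⧸ m)) 0)) :
    fiberRank m (C →ₗ[R] M) * fiberRank m C = fiberRank m B * fiberRank m M * fiberRank m B := by
  let _ : Field (R ⧸ m) := Ideal.Quotient.field m
  have := hB.finite
  have := hC.finite
  obtain ⟨e⟩ := h
  obtain ⟨e₁⟩ := extProj_zero_equiv hC M (ModuleCat.of R (R ⧸ m))
  obtain ⟨e₂⟩ := extInj_zero_equiv hB M (ModuleCat.of R (R ⧸ m))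
  let e' : ((C →ₗ[R] M) →ₗ[R] (C →ₗ[R] R ⧸ m)) ≃ₗ[R] (B ⊗[R] M →ₗ[R] (R ⧸ m) ⊗[R] B) :=
    e₁.symm ≪≫ₗ e ≪≫ₗ e₂ ≪≫ₗ (TensorProduct.comm R B (R ⧸ m)).congrRight
  have key := finrank_eq_of_linearEquiv m e'
  rwa [finrank_linearMap_fiber, finrank_linearMap_fiber, finrank_linearMap_fiber,
    Module.finrank_self, mul_one, fiberRank_tensorProduct] at key

/-- Taking M = C, where Hom(C, C) ≅ R has fiber rank 1, gives c = b·c·b; cancelling c ≠ 0 leaves b²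
= 1. -/
lemma fiberRank_eq_one_of_extZero_equiv (hB : IsSemidualizing B) (hC : IsSemidualizing C)
    (m : Ideal R) [m.IsMaximal]
    (h : Nonempty (ExtProj C C (ModuleCat.of R (R ⧸ m)) 0 ≃ₗ[R]
      ExtInj B C (ModuleCat.of R (R ⧸ m)) 0)) : fiberRank m B = 1 := by
  have := hC.finite
  have h1 := fiberRank_eq_of_extZero_equiv hB hC C m h
  rw [← fiberRank_congr m (LinearEquiv.ofBijective _ hC.homothety), fiberRank_self] at h1
  have h2 := fiberRank_ne_zero m hC.homothety.1
  have h3 : fiberRank m B * fiberRank m B = 1 := by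
    apply Nat.eq_of_mul_eq_mul_right (Nat.pos_of_ne_zero h2)
    linarith
  exact Nat.eq_one_of_mul_eq_one_left h3

lemma projective_of_extZero_equiv (hB : IsSemidualizing B) (hC : IsSemidualizing C)
    (h : ∀ (m : Ideal R), m.IsMaximal → Nonempty (ExtProj C C (ModuleCat.of R (R ⧸ m)) 0 ≃ₗ[R]
      ExtInj B C (ModuleCat.of R (R ⧸ m)) 0)) : Module.Projective R B :=
  have := hB.finite
  Module.Projective.of_finrank_fiber_eq_one hB.homothety.1 fun m hm =>
    fiberRank_eq_one_of_extZero_equiv hB hC m (h m hm)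

end SemidualizingBalance

open SemidualizingBalance

/-! ### The equivalences. -/

theorem theorem3p4 {R : Type u} [CommRing R] [IsNoetherianRing R] (B C : ModuleCat.{u} R)
    (hB : IsSemidualizing B) (hC : IsSemidualizing C) :
    List.TFAE [
      PicRel B (ModuleCat.of R R) ∧ PicRel (ModuleCat.of R R) C,
      Module.Projective R B ∧ Module.Projective R C,
      ∀ (M N : ModuleCat.{u} R) (i : ℕ), Nonempty (ExtProj C M N i ≃ₗ[R] ExtInj B M N i),
      ∀ (m : Ideal R), m.IsMaximal → ∀ i : ℕ,
        Nonempty (ExtProj C C (ModuleCat.of R (R ⧸ m)) i ≃ₗ[R]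
          ExtInj B C (ModuleCat.of R (R ⧸ m)) i),
      ∀ (m : Ideal R), m.IsMaximal →
        Nonempty (ExtProj C C (ModuleCat.of R (R ⧸ m)) 0 ≃ₗ[R]
          ExtInj B C (ModuleCat.of R (R ⧸ m)) 0) ∧
        Nonempty (ExtProj C B (ModuleCat.of R (R ⧸ m)) 0 ≃ₗ[R]
          ExtInj B B (ModuleCat.of R (R ⧸ m)) 0)] := by
  have := hB.finite
  have := hC.finite
  tfae_have 1 → 2 := by
    rintro ⟨⟨P, -, ⟨e⟩⟩, ⟨Q, hQ, ⟨e'⟩⟩⟩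
    have : Module.Invertible R B := Module.Invertible.left e.symm
    have := hQ.projective
    exact ⟨inferInstance,
      Module.Projective.of_equiv (e' ≪≫ₗ TensorProduct.lid R Q).symm⟩
  tfae_have 2 → 1 := by
    rintro ⟨hB', hC'⟩
    have := hB.invertible hB'
    have := hC.invertible hC'
    have hdual : Module.Invertible R (ModuleCat.of R (Module.Dual R B)) :=
      inferInstanceAs (Module.Invertible R (Module.Dual R B))
    -- The dual is the inverse of `B` in the Picard group, so it witnesses `R ≅ B ⊗ P`.
    exact ⟨⟨ModuleCat.of R (Module.Dual R B), isPicard_of_invertible _,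
        ⟨(TensorProduct.comm R B (Module.Dual R B) ≪≫ₗ Module.Invertible.linearEquiv R B).symm⟩⟩,
      ⟨C, isPicard_of_invertible C, ⟨(TensorProduct.lid R C).symm⟩⟩⟩
  tfae_have 2 → 3 := by
    rintro ⟨hB', hC'⟩ M N i
    have := hB.invertible hB'
    have := hC.invertible hC'
    obtain ⟨e⟩ := extProj_equiv_ext_of_invertible C M N i
    obtain ⟨e'⟩ := extInj_equiv_ext_of_invertible B M N i
    exact ⟨e ≪≫ₗ e'.symm⟩
  tfae_have 3 → 4 := fun h m _ i => h _ _ i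
  tfae_have 3 → 5 := fun h m _ => ⟨h _ _ 0, h _ _ 0⟩
  tfae_have 4 → 2 := by
    intro h
    have hB' := projective_of_extZero_equiv hB hC fun m hm => h m hm 0
    have := hB.invertible hB'
    refine ⟨hB', Module.Projective.of_subsingleton_ext_one C fun m hm => ?_⟩
    -- In degree 1 the `𝒫_C` side vanishes, while for invertible `B` the `ℐ_B` side is the ordinary
    -- Ext¹(C, R ⧸ m).
    have := subsingleton_extProj_self_one hC (ModuleCat.of R (R ⧸ m))
    obtain ⟨e⟩ := h m hm 1
    obtain ⟨e'⟩ := extInj_equiv_ext_of_invertible B C (ModuleCat.of R (R ⧸ m)) 1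
    exact (e ≪≫ₗ e').symm.injective.subsingleton
  tfae_have 5 → 2 := by
    intro h
    refine ⟨projective_of_extZero_equiv hB hC fun m hm => (h m hm).1,
      Module.Projective.of_finrank_fiber_eq_one hC.homothety.1 fun m hm => ?_⟩
    -- With `M = B` and `B` of fiber rank 1, the fiber ranks of Hom(C, B) and `C` multiply to 1.
    have h1 := fiberRank_eq_of_extZero_equiv hB hC B m (h m hm).2
    rw [fiberRank_eq_one_of_extZero_equiv hB hC m (h m hm).1] at h1
    exact Nat.eq_one_of_mul_eq_one_left h1
  tfae_finish
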